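/- Let $D\ge 1$. On $\mathbb{R}^{2D}$, with coordinates $v=(p_1,\dots,p_D,q_1,\dots,q_D)$, let $\omega(v,\tilde v)=\sum_{i=1}^D(p_i\tilde q_i-q_i\tilde p_i)$, and let $\mathcal H=\mathbb{R}^{2D}\times\mathbb{R}$ be the Heisenberg group with product $(v,u)(\tilde v,\tilde u)=(v+\tilde v,\,u+\tilde u+\tfrac12\omega(v,\tilde v))$. Let $e_1,\dots,e_D,f_1,\dots,f_D$ be the standard basis of $\mathbb{R}^{2D}$ ($e_i$ belonging to $p_i$ and $f_i$ to $q_i$), and let $H\subset\mathcal H$ be the discrete Heisenberg group, i.e. the subgroup generated by the elements $(e_i,0)$ and $(f_i,0)$, $1\le i\le D$. Let $d$ be a homogeneous metric on $\mathcal H$, i.e. a metric with $d(gf,hf)=d(g,h)$ for all $f,g,h\in\mathcal H$ and $d(\delta_r g,\delta_r h)=r\,d(g,h)$ for all $g,h\in\mathcal H$ and $r>0$, where $\delta_r(v,u)=(rv,r^2u)$. For $A\subset\mathcal H$ and $t\ge 0$ put $A^t=\{g\in\mathcal H: d(g,A)\le t\}$, where $d(g,A)=\inf\{d(g,h):h\in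 A\}$. Let $H$ act by homeomorphisms on a compact metric space $(\mathbb X,\rho)$. For $A\subset\mathcal H$ and $x,y\in\mathbb X$ put $\rho^A(x,y)=\sup\{\rho(gx,gy): g\in A\cap H\}$ (with $\sup\emptyset=0$). The set $A$ is called expansive if there are $\varepsilon>0$ and $t>0$ such that, for all $x,y\in\mathbb X$, $\rho^{A^t}(x,y)\le\varepsilon$ implies $x=y$; otherwise $A$ is called nonexpansive. A $2D$-dimensional vertical group is a normal subgroup of $\mathcal H$ of the form $V\times\mathbb{R}$ with $V$ a linear subspace of $\mathbb{R}^{2D}$ of dimension $2D-1$. Theorem. If $\mathbb X$ is infinite, then there is at least one nonexpansive $2D$-dimensional vertical group. -/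

import Mathlib

open scoped ENNReal

/-- The symplectic form `ω(v, w) = ∑ (pᵢ q̃ᵢ - qᵢ p̃ᵢ)` on `ℝ^{2D}`. The coordinates of a vector
along `eᵢ` and `fᵢ` are its entries at `Sum.inl i` and `Sum.inr i`. -/
noncomputable def symplecticForm {D : ℕ} (v w : EuclideanSpace ℝ (Fin D ⊕ Fin D)) : ℝ :=
  ∑ i : Fin D, (v (Sum.inl i) * w (Sum.inr i) - v (Sum.inr i) * w (Sum.inl i))

/-- The underlying set `ℝ^{2D} × ℝ` of the `(2D+1)`-dimensional Heisenberg group. -/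
@[ext]
structure Heisenberg (D : ℕ) where
  v : EuclideanSpace ℝ (Fin D ⊕ Fin D)
  u : ℝ

namespace Heisenberg

variable {D : ℕ}

/-- `(v, u) (v', u') = (v + v', u + u' + ω(v, v') / 2)`. -/
noncomputable instance : Mul (Heisenberg D) :=
  ⟨fun g h => ⟨g.v + h.v, g.u + h.u + (1 / 2 : ℝ) * symplecticForm g.v h.v⟩⟩

noncomputable instance : One (Heisenberg D) := ⟨⟨0, 0⟩⟩

noncomputable instance : Inv (Heisenberg D) := ⟨fun g => ⟨-g.v, -g.u⟩⟩

@[simp] theorem mul_v (g h : Heisenberg D) : (g * h).v = g.v + h.v := rfl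

@[simp] theorem mul_u (g h : Heisenberg D) :
    (g * h).u = g.u + h.u + (1 / 2 : ℝ) * symplecticForm g.v h.v := rfl

@[simp] theorem one_v : (1 : Heisenberg D).v = 0 := rfl

@[simp] theorem one_u : (1 : Heisenberg D).u = 0 := rfl

@[simp] theorem inv_v (g : Heisenberg D) : (g⁻¹).v = -g.v := rfl

@[simp] theorem inv_u (g : Heisenberg D) : (g⁻¹).u = -g.u := rfl

noncomputable instance : Group (Heisenberg D) :=
  Group.ofLeftAxioms
    (by
      intro a b c
      ext
      · simp [add_assoc]
      · simp only [mul_u, mul_v, symplecticForm, PiLp.add_apply, add_mul, mul_add,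
          Finset.sum_sub_distrib, Finset.sum_add_distrib]
        ring)
    (by
      intro a
      ext <;> simp [symplecticForm])
    (by
      intro a
      ext
      · simp
      · simp [symplecticForm, mul_comm])

/-- The generator `xᵢ = (eᵢ, 0)`. -/
noncomputable def x (i : Fin D) : Heisenberg D := ⟨EuclideanSpace.single (Sum.inl i) 1, 0⟩

/-- The generator `yᵢ = (fᵢ, 0)`. -/
noncomputable def y (i : Fin D) : Heisenberg D := ⟨EuclideanSpace.single (Sum.inr i) 1, 0⟩

/-- The discrete Heisenberg group, generated by the `xᵢ` and `yᵢ`. -/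
noncomputable def discrete (D : ℕ) : Subgroup (Heisenberg D) :=
  Subgroup.closure (Set.range x ∪ Set.range y)

/-- The dilation `δ_r (v, u) = (r v, r² u)`. -/
noncomputable def dilation (r : ℝ) (g : Heisenberg D) : Heisenberg D :=
  ⟨r • g.v, r ^ 2 * g.u⟩

/-- `d` is a metric on the Heisenberg group that is right invariant and scales with the
dilations. -/
structure IsHomogeneousMetric (d : Heisenberg D → Heisenberg D → ℝ) : Prop where
  eq_zero_iff : ∀ g h, d g h = 0 ↔ g = h
  symm : ∀ g h, d g h = d h g
  triangle : ∀ f g h, d f h ≤ d f g + d g h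
  right_invariant : ∀ f g h, d (g * f) (h * f) = d g h
  dilation : ∀ r : ℝ, 0 < r → ∀ g h, d (dilation r g) (dilation r h) = r * d g h

/-- The thickening `A^t = {g | d(g, A) ≤ t}`, where `d(g, A) = inf {d(g, h) | h ∈ A}`
(computed in `[0, ∞]`, so that it is `∞` for empty `A`). -/
def thickening (d : Heisenberg D → Heisenberg D → ℝ) (A : Set (Heisenberg D)) (t : ℝ) :
    Set (Heisenberg D) :=
  {g | (⨅ h ∈ A, ENNReal.ofReal (d g h)) ≤ ENNReal.ofReal t}

/-- `ρ^A(p, q) = sup {ρ(g p, g q) | g ∈ A ∩ H}`, with `H` the discrete Heisenberg group, as an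
element of `[0, ∞]`. -/
noncomputable def supDist {X : Type*} [MetricSpace X] [MulAction (discrete D) X]
    (A : Set (Heisenberg D)) (p q : X) : ℝ≥0∞ :=
  ⨆ g : discrete D, ⨆ _ : (g : Heisenberg D) ∈ A, edist (g • p) (g • q)

/-- `A` is expansive for the action of the discrete Heisenberg group on `X`: there are `ε > 0` and
`t > 0` such that `ρ^{A^t}(p, q) ≤ ε` implies `p = q`. -/
def IsExpansive (d : Heisenberg D → Heisenberg D → ℝ) (X : Type*) [MetricSpace X]
    [MulAction (discrete D) X] (A : Set (Heisenberg D)) : Prop :=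
  ∃ ε : ℝ, 0 < ε ∧ ∃ t : ℝ, 0 < t ∧
    ∀ p q : X, supDist (thickening d A t) p q ≤ ENNReal.ofReal ε → p = q

/-- `G` is a `k`-dimensional vertical group: a normal subgroup of the form `V × ℝ` with `V` a linear
subspace of `ℝ^{2D}` of dimension `k - 1`. -/
def IsVerticalGroup (G : Subgroup (Heisenberg D)) (k : ℕ) : Prop :=
  G.Normal ∧ ∃ V : Submodule ℝ (EuclideanSpace ℝ (Fin D ⊕ Fin D)),
    Module.finrank ℝ V + 1 = k ∧ (G : Set (Heisenberg D)) = {g | g.v ∈ V}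

end Heisenberg

/-! Suppose every vertical hyperplane group is expansive. A homogeneous metric dominates the
Euclidean norm of the horizontal part (`exists_norm_v_le`), so each thickening lies in a slab, and
for every unit vector `n` some slab `|⟪n, v⟫| ≤ C` determines points.

By compactness of `X`, finitely many elements of a slab already control a coordinate far outside it.
After translation, closeness at the identity follows from closeness on a finite set in an open
half-space (`exists_finite_halfSpace`). Compactness of the unit sphere makes this uniform in `n`.
Closeness then propagates outwards from a large horizontal ball, so the cylinder over that ball
determines points (`exists_closeOn_cylinder`). Modulo the centre this cylinder is finite, hence
finitely many cosets of `⟨z⟩`, with `z` a central commutator, determine points.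

Commutators are quadratically distorted: `z ^ (k * k)` is a word of length `4 * k` in `a`, `b` and
their inverses, and a code along `⟨z⟩` reaches it at a cost linear in `k`. For large `k` a finite
central block therefore controls all of `⟨z⟩`, so finitely many coordinates separate points and `X`
is discrete, hence finite (`finite_of_expansive_central_commutator`). -/

theorem Continuous.symplecticForm {D : ℕ} {T : Type*} [TopologicalSpace T]
    {f g : T → EuclideanSpace ℝ (Fin D ⊕ Fin D)} (hf : Continuous f) (hg : Continuous g) :
    Continuous fun t => symplecticForm (f t) (g t) := by
  unfold _root_.symplecticForm
  fun_prop

/-! ### Homogeneous metrics and the Euclidean topology -/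

namespace Heisenberg

variable {D : ℕ}

theorem dilation_one (r : ℝ) : dilation r (1 : Heisenberg D) = 1 := by
  ext1 <;> simp [dilation]

namespace IsHomogeneousMetric

variable {d : Heisenberg D → Heisenberg D → ℝ}

theorem self_eq_zero (hd : IsHomogeneousMetric d) (g : Heisenberg D) : d g g = 0 :=
  (hd.eq_zero_iff g g).2 rfl

theorem nonneg (hd : IsHomogeneousMetric d) (g h : Heisenberg D) : 0 ≤ d g h := by
  have h1 := hd.triangle g h g
  rw [hd.self_eq_zero, hd.symm h g] at h1
  linarith

theorem eq_mul_inv_one (hd : IsHomogeneousMetric d) (g h : Heisenberg D) :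
    d g h = d (g * h⁻¹) 1 := by
  rw [← hd.right_invariant h⁻¹ g h, mul_inv_cancel]

theorem mul_one_le (hd : IsHomogeneousMetric d) (g h : Heisenberg D) :
    d (g * h) 1 ≤ d g 1 + d h 1 := by
  have h1 := hd.triangle (g * h) h 1
  have h2 := hd.right_invariant h g 1
  rw [one_mul] at h2
  linarith

theorem dilation_one (hd : IsHomogeneousMetric d) {r : ℝ} (hr : 0 < r) (g : Heisenberg D) :
    d (Heisenberg.dilation r g) 1 = r * d g 1 := by
  rw [← hd.dilation r hr, Heisenberg.dilation_one]

theorem inv_one (hd : IsHomogeneousMetric d) (g : Heisenberg D) : d g⁻¹ 1 = d g 1 := by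
  rw [← hd.right_invariant g g⁻¹ 1, inv_mul_cancel, one_mul, hd.symm]

theorem single_le (hd : IsHomogeneousMetric d) (j : Fin D ⊕ Fin D) (a : ℝ) :
    d ⟨EuclideanSpace.single j a, 0⟩ 1 ≤ |a| * d ⟨EuclideanSpace.single j 1, 0⟩ 1 := by
  rcases lt_trichotomy a 0 with ha | rfl | ha
  · rw [abs_of_neg ha, ← hd.dilation_one (neg_pos.2 ha), ← hd.inv_one]
    refine le_of_eq (congrArg (fun g => d g 1) ?_)
    ext1
    · ext i
      by_cases hi : i = j <;> simp [Heisenberg.dilation, hi]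
    · simp [Heisenberg.dilation]
  · refine le_of_eq ?_
    rw [abs_zero, zero_mul, hd.eq_zero_iff]
    ext1
    · ext i
      by_cases hi : i = j <;> simp
    · simp
  · rw [abs_of_pos ha, ← hd.dilation_one ha]
    refine le_of_eq (congrArg (fun g => d g 1) ?_)
    ext1
    · ext i
      by_cases hi : i = j <;> simp [Heisenberg.dilation, hi]
    · simp [Heisenberg.dilation]

/-- Dilations act on the centre by `r ^ 2`, which produces the square root; inversion handles
negative `u`. -/
theorem center_le (hd : IsHomogeneousMetric d) (u : ℝ) :
    d ⟨0, u⟩ 1 ≤ √|u| * d ⟨0, 1⟩ 1 := by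
  rcases lt_trichotomy u 0 with hu | rfl | hu
  · rw [← hd.dilation_one (Real.sqrt_pos.2 (abs_pos.2 hu.ne)), ← hd.inv_one]
    refine le_of_eq (congrArg (fun g => d g 1) ?_)
    ext1
    · simp [Heisenberg.dilation]
    · simp [Heisenberg.dilation, abs_of_neg hu, Real.sq_sqrt (neg_pos.2 hu).le]
  · refine le_of_eq ?_
    rw [abs_zero, Real.sqrt_zero, zero_mul, hd.eq_zero_iff]
    rfl
  · rw [← hd.dilation_one (Real.sqrt_pos.2 (abs_pos.2 hu.ne'))]
    refine le_of_eq (congrArg (fun g => d g 1) ?_)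
    ext1
    · simp [Heisenberg.dilation]
    · simp [Heisenberg.dilation, abs_of_pos hu, Real.sq_sqrt hu.le]

-- Coordinates are added one at a time; each product creates a central error, a value of the
-- symplectic form, which vanishes as `v → 0`.
open Filter Topology in
theorem tendsto_sum_single (hd : IsHomogeneousMetric d) (s : Finset (Fin D ⊕ Fin D)) :
    Tendsto (fun v : EuclideanSpace ℝ (Fin D ⊕ Fin D) =>
      d ⟨∑ j ∈ s, EuclideanSpace.single j (v j), 0⟩ 1) (𝓝 0) (𝓝 0) := by
  classical
  induction s using Finset.induction_on with
  | empty =>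
    have : (⟨0, 0⟩ : Heisenberg D) = 1 := rfl
    simp [this, hd.self_eq_zero]
  | insert j s hj ih =>
    let f : EuclideanSpace ℝ (Fin D ⊕ Fin D) → ℝ := fun v =>
      (1 / 2) * symplecticForm (EuclideanSpace.single j (v j))
        (∑ j ∈ s, EuclideanSpace.single j (v j))
    have hsing : ∀ j : Fin D ⊕ Fin D, Continuous fun v : EuclideanSpace ℝ (Fin D ⊕ Fin D) =>
        EuclideanSpace.single j (v j) := by
      intro j
      have : (fun v : EuclideanSpace ℝ (Fin D ⊕ Fin D) => EuclideanSpace.single j (v j)) =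
          fun v => (v j) • EuclideanSpace.single j (1 : ℝ) := by
        ext v i
        by_cases hi : i = j <;> simp [hi]
      rw [this]
      fun_prop
    have hf : Continuous f := by
      refine continuous_const.mul ((hsing j).symplecticForm ?_)
      exact continuous_finsetSum _ fun j _ => hsing j
    have hf0 : f 0 = 0 := by simp [f, symplecticForm]
    refine squeeze_zero (fun v => hd.nonneg _ _) (g := fun v =>
      (|v j| * d ⟨EuclideanSpace.single j 1, 0⟩ 1 +
        d ⟨∑ j ∈ s, EuclideanSpace.single j (v j), 0⟩ 1) + √|f v| * d ⟨0, 1⟩ 1) ?_ ?_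
    · intro v
      have key : (⟨∑ j ∈ insert j s, EuclideanSpace.single j (v j), 0⟩ : Heisenberg D) =
          (⟨EuclideanSpace.single j (v j), 0⟩ * ⟨∑ j ∈ s, EuclideanSpace.single j (v j), 0⟩) *
            ⟨0, -f v⟩ := by
        ext1
        · simp [Finset.sum_insert hj]
        · simp [f, symplecticForm]
      rw [key]
      refine (hd.mul_one_le _ _).trans (add_le_add ((hd.mul_one_le _ _).trans ?_) ?_)
      · exact add_le_add (hd.single_le _ _) le_rfl
      · simpa using hd.center_le (-f v)
    · have h1 : Tendsto (fun v : EuclideanSpace ℝ (Fin D ⊕ Fin D) =>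
          |v j| * d ⟨EuclideanSpace.single j 1, 0⟩ 1) (𝓝 0) (𝓝 0) := by
        have : Continuous fun v : EuclideanSpace ℝ (Fin D ⊕ Fin D) =>
          |v j| * d ⟨EuclideanSpace.single j 1, 0⟩ 1 := by fun_prop
        simpa using this.tendsto 0
      have h2 : Tendsto (fun v => √|f v| * d ⟨0, 1⟩ 1) (𝓝 0) (𝓝 0) := by
        have : Continuous fun v => √|f v| * d ⟨0, 1⟩ 1 := by fun_prop
        simpa [hf0] using this.tendsto 0
      simpa using (h1.add ih).add h2

open Filter Topology in
theorem tendsto_one (hd : IsHomogeneousMetric d) :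
    Tendsto (fun w : EuclideanSpace ℝ (Fin D ⊕ Fin D) × ℝ => d ⟨w.1, w.2⟩ 1) (𝓝 0) (𝓝 0) := by
  refine squeeze_zero (fun v => hd.nonneg _ _) (g := fun w =>
    d ⟨∑ j, EuclideanSpace.single j (w.1 j), 0⟩ 1 + √|w.2| * d ⟨0, 1⟩ 1) ?_ ?_
  · intro w
    have key : (⟨w.1, w.2⟩ : Heisenberg D) =
        ⟨∑ j, EuclideanSpace.single j (w.1 j), 0⟩ * ⟨0, w.2⟩ := by
      ext1
      · ext i
        simp [Finset.sum_pi_single, -Fintype.sum_sum_type]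
      · simp [symplecticForm]
    rw [key]
    exact (hd.mul_one_le _ _).trans (add_le_add le_rfl (hd.center_le _))
  · have h1 := (hd.tendsto_sum_single Finset.univ).comp
      ((continuous_fst (X := EuclideanSpace ℝ (Fin D ⊕ Fin D)) (Y := ℝ)).tendsto 0)
    have h2 : Tendsto (fun w : EuclideanSpace ℝ (Fin D ⊕ Fin D) × ℝ => √|w.2| * d ⟨0, 1⟩ 1)
        (𝓝 0) (𝓝 0) := by
      have : Continuous fun w : EuclideanSpace ℝ (Fin D ⊕ Fin D) × ℝ =>
        √|w.2| * d ⟨0, 1⟩ 1 := by fun_prop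
      simpa using this.tendsto 0
    simpa using h1.add h2

-- By the triangle inequality `d g 1` changes by at most `d g g₀ = d (g * g₀⁻¹) 1`, so right
-- invariance reduces continuity everywhere to the limit at the identity.
open Filter Topology in
theorem continuous_one (hd : IsHomogeneousMetric d) :
    Continuous fun w : EuclideanSpace ℝ (Fin D ⊕ Fin D) × ℝ => d ⟨w.1, w.2⟩ 1 := by
  rw [continuous_iff_continuousAt]
  intro w₀
  have hc : Continuous fun w : EuclideanSpace ℝ (Fin D ⊕ Fin D) × ℝ =>
      ((w.1 - w₀.1, w.2 - w₀.2 + (1 / 2) * symplecticForm w.1 (-w₀.1)) :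
        EuclideanSpace ℝ (Fin D ⊕ Fin D) × ℝ) := by
    have h1 : Continuous fun w : EuclideanSpace ℝ (Fin D ⊕ Fin D) × ℝ =>
      symplecticForm w.1 (-w₀.1) := continuous_fst.symplecticForm continuous_const
    fun_prop
  have h0 : symplecticForm w₀.1 (-w₀.1) = 0 := by
    simp [symplecticForm, mul_comm]
  have ht := hc.tendsto w₀
  simp only [sub_self, h0, mul_zero, add_zero] at ht
  have ht' := hd.tendsto_one.comp ht
  rw [ContinuousAt, tendsto_iff_dist_tendsto_zero]
  refine squeeze_zero (fun _ => dist_nonneg) (fun w => ?_) ht'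
  have e : (⟨w.1 - w₀.1, w.2 - w₀.2 + (1 / 2) * symplecticForm w.1 (-w₀.1)⟩ : Heisenberg D) =
      ⟨w.1, w.2⟩ * (⟨w₀.1, w₀.2⟩ : Heisenberg D)⁻¹ := by
    ext1
    · simp [sub_eq_add_neg]
    · simp [sub_eq_add_neg]
  simp only [Function.comp_apply, e, ← hd.eq_mul_inv_one, Real.dist_eq]
  have t1 := hd.triangle ⟨w.1, w.2⟩ ⟨w₀.1, w₀.2⟩ 1
  have t2 := hd.triangle ⟨w₀.1, w₀.2⟩ ⟨w.1, w.2⟩ 1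
  rw [hd.symm ⟨w₀.1, w₀.2⟩ ⟨w.1, w.2⟩] at t2
  exact abs_le.2 ⟨by linarith, by linarith⟩

/-- A homogeneous metric dominates the Euclidean norm of the horizontal component. -/
theorem exists_norm_v_le (hd : IsHomogeneousMetric d) :
    ∃ C : ℝ, 0 < C ∧ ∀ g : Heisenberg D, ‖g.v‖ ≤ C * d g 1 := by
  have hne : (Metric.sphere (0 : EuclideanSpace ℝ (Fin D ⊕ Fin D) × ℝ) 1).Nonempty :=
    ⟨(0, 1), by simp⟩
  obtain ⟨w, hw, hmin⟩ := (isCompact_sphere (0 : EuclideanSpace ℝ (Fin D ⊕ Fin D) × ℝ)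
    1).exists_isMinOn hne hd.continuous_one.continuousOn
  have hc : 0 < d ⟨w.1, w.2⟩ 1 := by
    refine lt_of_le_of_ne (hd.nonneg _ _) fun h => ?_
    have h1 := (hd.eq_zero_iff _ _).1 h.symm
    have h2 : w = 0 := Prod.ext (congrArg Heisenberg.v h1) (congrArg Heisenberg.u h1)
    simp [h2] at hw
  set c := d ⟨w.1, w.2⟩ 1
  refine ⟨c⁻¹, inv_pos.2 hc, fun g => ?_⟩
  rw [inv_mul_eq_div, le_div_iff₀ hc]
  rcases eq_or_ne g.v 0 with h0 | h0
  · simpa [h0] using hd.nonneg g 1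
  -- This gauge is homogeneous under dilations, and dilating by `r⁻¹` lands on the unit sphere of
  -- the sup norm, where `d · 1` is at least `c`.
  set r := max ‖g.v‖ √|g.u|
  have hr : 0 < r := lt_max_of_lt_left (norm_pos_iff.2 h0)
  have hmem : ((r⁻¹ • g.v, r⁻¹ ^ 2 * g.u) : EuclideanSpace ℝ (Fin D ⊕ Fin D) × ℝ) ∈
      Metric.sphere (0 : EuclideanSpace ℝ (Fin D ⊕ Fin D) × ℝ) 1 := by
    have e1 : ‖r⁻¹ • g.v‖ = ‖g.v‖ / r := by
      rw [norm_smul, norm_inv, Real.norm_of_nonneg hr.le, inv_mul_eq_div]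
    have e2 : ‖r⁻¹ ^ 2 * g.u‖ = (√|g.u| / r) ^ 2 := by
      rw [norm_mul, norm_pow, norm_inv, Real.norm_of_nonneg hr.le, div_pow,
        Real.sq_sqrt (abs_nonneg _), Real.norm_eq_abs]
      field_simp
    rw [mem_sphere_zero_iff_norm, Prod.norm_mk, e1, e2]
    have l1 : ‖g.v‖ / r ≤ 1 := (div_le_one hr).2 (le_max_left _ _)
    have l2 : √|g.u| / r ≤ 1 := (div_le_one hr).2 (le_max_right _ _)
    have l3 : 0 ≤ √|g.u| / r := by positivity
    rcases max_choice ‖g.v‖ √|g.u| with h | h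
    · have h1 : ‖g.v‖ / r = 1 := (div_eq_one_iff_eq hr.ne').2 h.symm
      rw [h1]
      exact max_eq_left (pow_le_one₀ l3 l2)
    · have h1 : √|g.u| / r = 1 := (div_eq_one_iff_eq hr.ne').2 h.symm
      rw [h1, one_pow]
      exact max_eq_right l1
  have hle : c ≤ d (Heisenberg.dilation r⁻¹ g) 1 := hmin hmem
  rw [hd.dilation_one (inv_pos.2 hr), inv_mul_eq_div, le_div_iff₀ hr] at hle
  calc ‖g.v‖ * c ≤ r * c := mul_le_mul_of_nonneg_right (le_max_left _ _) hc.le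
    _ = c * r := mul_comm _ _
    _ ≤ d g 1 := hle

end IsHomogeneousMetric

end Heisenberg

/-! ### Finite codes, slabs and cylinders -/

section Coding

variable {Γ X : Type*} [Group Γ] [MetricSpace X] [MulAction Γ X]

/-- The points `p` and `q` stay `ε`-close along the part `S` of their orbits. -/
def CloseOn (ε : ℝ) (S : Set Γ) (p q : X) : Prop :=
  ∀ g ∈ S, dist (g • p) (g • q) ≤ ε

theorem CloseOn.mono {ε ε' : ℝ} {S T : Set Γ} {p q : X} (h : CloseOn ε T p q) (hST : S ⊆ T)
    (hε : ε ≤ ε') : CloseOn ε' S p q :=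
  fun g hg => (h g (hST hg)).trans hε

variable [CompactSpace X] [ContinuousConstSMul Γ X]

/-- If closeness along `S` determines points, then a finite part of `S` determines finitely many
coordinates up to any given precision. -/
theorem exists_finite_closeOn {ε : ℝ} {S : Set Γ} (hS : ∀ p q : X, CloseOn ε S p q → p = q)
    {δ : ℝ} (hδ : 0 < δ) {K : Set Γ} (hK : K.Finite) :
    ∃ F ⊆ S, F.Finite ∧ ∀ p q : X, CloseOn ε F p q → ∀ k ∈ K, dist (k • p) (k • q) < δ := by
  -- `W` is compact and misses the diagonal, which is the intersection of the closed conditions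
  -- indexed by `S`.
  let W : Set (X × X) := ⋃ k ∈ K, {w | δ ≤ dist (k • w.1) (k • w.2)}
  have hW : IsClosed W := hK.isClosed_biUnion fun k _ =>
    isClosed_le continuous_const (by fun_prop)
  obtain ⟨u, hu⟩ := hW.isCompact.elim_finite_subfamily_closed
    (fun g : S => {w : X × X | dist ((g : Γ) • w.1) ((g : Γ) • w.2) ≤ ε})
    (fun g => isClosed_le (by fun_prop) continuous_const) (by
      rw [Set.eq_empty_iff_forall_notMem]
      rintro ⟨p, q⟩ ⟨hw, hi⟩
      have hpq : p = q := hS p q fun g hg => Set.mem_iInter.1 hi ⟨g, hg⟩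
      subst hpq
      obtain ⟨k, -, hk⟩ := Set.mem_iUnion₂.1 hw
      simp only [Set.mem_ofPred_eq, dist_self] at hk
      exact hδ.not_ge hk)
  refine ⟨Subtype.val '' (u : Set S), by rintro _ ⟨g, -, rfl⟩; exact g.2,
    u.finite_toSet.image _, fun p q hF k hk => ?_⟩
  by_contra! hlt
  have hmem : (p, q) ∈ W ∩ ⋂ g ∈ u, {w : X × X | dist ((g : Γ) • w.1) ((g : Γ) • w.2) ≤ ε} :=
    ⟨Set.mem_iUnion₂.2 ⟨k, hk, hlt⟩, Set.mem_iInter₂.2 fun g hg => hF g ⟨g, hg, rfl⟩⟩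
  rw [hu] at hmem
  exact hmem

variable {E : Type*} [NormedAddCommGroup E] [InnerProductSpace ℝ E]

open scoped RealInnerProductSpace

/-- If every slab is expansive, then all slabs of sufficient width are expansive with a common
constant. -/
theorem exists_uniform_slab [Nontrivial E] (φ : Γ →* Multiplicative E)
    (hslab : ∀ n : E, ‖n‖ = 1 → ∃ ε > 0, ∃ C : ℝ, ∀ p q : X,
      CloseOn ε {g : Γ | |⟪n, (φ g).toAdd⟫| ≤ C} p q → p = q) :
    ∃ ε > 0, ∀ n : E, ‖n‖ = 1 → ∃ C : ℝ, ∀ p q : X,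
      CloseOn ε {g : Γ | |⟪n, (φ g).toAdd⟫| ≤ C} p q → p = q := by
  obtain ⟨n₀, hn₀⟩ := exists_norm_eq E zero_le_one
  obtain ⟨ε₀, hε₀, C₀, h₀⟩ := hslab n₀ hn₀
  refine ⟨ε₀, hε₀, fun n hn => ?_⟩
  obtain ⟨ε, hε, C, h⟩ := hslab n hn
  obtain ⟨F, -, hF, hcode⟩ := exists_finite_closeOn (Γ := Γ) (X := X) (S := Set.univ)
    (fun p q hpq => h₀ p q (hpq.mono (Set.subset_univ _) le_rfl)) hε (Set.finite_singleton 1)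
  -- Widening the slab by the extent `M` of the code `F` upgrades `ε₀`-closeness to `ε`-closeness on
  -- the original slab.
  obtain ⟨M, hM⟩ := (hF.image fun g => |⟪n, (φ g).toAdd⟫|).bddAbove
  refine ⟨M + C, fun p q hpq => h p q fun g hg => ?_⟩
  have := hcode (g • p) (g • q) (fun f hf => ?_) 1 rfl
  · simpa using this.le
  · rw [← mul_smul, ← mul_smul]
    refine hpq _ ?_
    rw [Set.mem_ofPred_eq, map_mul, toAdd_mul, inner_add_right]
    exact (abs_add_le _ _).trans (add_le_add (hM ⟨f, hf, rfl⟩) hg)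

/-- An expansive slab codes the identity from a finite subset of an open half-space. -/
theorem exists_finite_halfSpace (φ : Γ →* Multiplicative E) {n : E}
    (hφ : ∃ g, ⟪n, (φ g).toAdd⟫ ≠ 0) {ε : ℝ} (hε : 0 < ε) {C : ℝ}
    (hslab : ∀ p q : X, CloseOn ε {g : Γ | |⟪n, (φ g).toAdd⟫| ≤ C} p q → p = q) :
    ∃ F : Set Γ, F.Finite ∧ (∀ f ∈ F, ⟪n, (φ f).toAdd⟫ < 0) ∧
      ∀ p q : X, CloseOn ε F p q → dist p q ≤ ε := by
  obtain ⟨k, hk⟩ : ∃ k : Γ, C < ⟪n, (φ k).toAdd⟫ := by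
    obtain ⟨g, hg⟩ := hφ
    wlog hpos : 0 < ⟪n, (φ g).toAdd⟫ generalizing g
    · refine this g⁻¹ ?_ ?_
      · simpa using hg
      · simpa using lt_of_le_of_ne (not_lt.1 hpos) hg
    obtain ⟨m, hm⟩ := exists_nat_gt (C / ⟪n, (φ g).toAdd⟫)
    refine ⟨g ^ m, ?_⟩
    rw [map_pow, toAdd_pow, ← Nat.cast_smul_eq_nsmul ℝ, inner_smul_right]
    exact (div_lt_iff₀ hpos).1 hm
  obtain ⟨F, hFS, hF, hcode⟩ := exists_finite_closeOn hslab hε (Set.finite_singleton k)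
  -- Since `k` lies beyond the slab, right translation by `k⁻¹` moves the coded element to `1` and
  -- the code strictly below the hyperplane.
  refine ⟨(· * k⁻¹) '' F, hF.image _, ?_, fun p q hpq => ?_⟩
  · rintro _ ⟨f, hf, rfl⟩
    have h1 : ⟪n, (φ f).toAdd⟫ ≤ C := (le_abs_self _).trans (hFS hf)
    simp only [map_mul, map_inv, toAdd_mul, toAdd_inv, inner_add_right, inner_neg_right]
    linarith
  · have := hcode (k⁻¹ • p) (k⁻¹ • q) (fun f hf => ?_) k rfl
    · simpa using this.le
    · rw [← mul_smul, ← mul_smul]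
      exact hpq _ ⟨f, hf, rfl⟩

/-- If every slab is expansive, then a large enough ball (a cylinder over the kernel of `φ`) is
expansive. -/
theorem exists_closeOn_cylinder [Nontrivial E] [FiniteDimensional ℝ E]
    (φ : Γ →* Multiplicative E) (hφ : ∀ n : E, n ≠ 0 → ∃ g, ⟪n, (φ g).toAdd⟫ ≠ 0)
    (hslab : ∀ n : E, ‖n‖ = 1 → ∃ ε > 0, ∃ C : ℝ, ∀ p q : X,
      CloseOn ε {g : Γ | |⟪n, (φ g).toAdd⟫| ≤ C} p q → p = q) :
    ∃ ε > 0, ∃ R : ℝ, ∀ p q : X, CloseOn ε {g : Γ | ‖(φ g).toAdd‖ ≤ R} p q → p = q := by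
  obtain ⟨ε, hε, huni⟩ := exists_uniform_slab φ hslab
  have hunif : ∃ η > 0, ∃ M : ℝ, ∀ n ∈ Metric.sphere (0 : E) 1, ∃ F : Set Γ,
      (∀ f ∈ F, ⟪n, (φ f).toAdd⟫ ≤ -η ∧ ‖(φ f).toAdd‖ ≤ M) ∧
        ∀ p q : X, CloseOn ε F p q → dist p q ≤ ε := by
    refine (isCompact_sphere (0 : E) 1).induction_on (p := fun s => ∃ η > 0, ∃ M : ℝ,
      ∀ n ∈ s, ∃ F : Set Γ, (∀ f ∈ F, ⟪n, (φ f).toAdd⟫ ≤ -η ∧ ‖(φ f).toAdd‖ ≤ M) ∧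
        ∀ p q : X, CloseOn ε F p q → dist p q ≤ ε) ?_ ?_ ?_ ?_
    · exact ⟨1, one_pos, 0, fun n hn => hn.elim⟩
    · rintro s t hst ⟨η, hη, M, h⟩
      exact ⟨η, hη, M, fun n hn => h n (hst hn)⟩
    · rintro s t ⟨η, hη, M, h⟩ ⟨η', hη', M', h'⟩
      refine ⟨min η η', lt_min hη hη', max M M', fun n hn => ?_⟩
      rcases hn with hn | hn
      · obtain ⟨F, hF, hc⟩ := h n hn
        exact ⟨F, fun f hf => ⟨(hF f hf).1.trans (neg_le_neg (min_le_left _ _)),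
          (hF f hf).2.trans (le_max_left _ _)⟩, hc⟩
      · obtain ⟨F, hF, hc⟩ := h' n hn
        exact ⟨F, fun f hf => ⟨(hF f hf).1.trans (neg_le_neg (min_le_right _ _)),
          (hF f hf).2.trans (le_max_right _ _)⟩, hc⟩
    · intro n hn
      have hn1 : ‖n‖ = 1 := by simpa using hn
      obtain ⟨C, hC⟩ := huni n hn1
      obtain ⟨F, hF, hneg, hc⟩ := exists_finite_halfSpace φ
        (hφ n (norm_ne_zero_iff.1 (by simp [hn1]))) hε hC
      obtain ⟨η, hη, hηF⟩ : ∃ η > 0, ∀ f ∈ F, ⟪n, (φ f).toAdd⟫ < -η := by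
        rcases F.eq_empty_or_nonempty with rfl | hne
        · exact ⟨1, one_pos, by simp⟩
        · obtain ⟨f₀, hf₀, hmax⟩ := hF.exists_maximalFor (fun f => ⟪n, (φ f).toAdd⟫) F hne
          have h0 := hneg f₀ hf₀
          refine ⟨-⟪n, (φ f₀).toAdd⟫ / 2, by linarith, fun f hf => ?_⟩
          have : ⟪n, (φ f).toAdd⟫ ≤ ⟪n, (φ f₀).toAdd⟫ := by
            by_contra! hlt
            exact hlt.not_ge (hmax hf hlt.le)
          linarith
      obtain ⟨M, hM⟩ := (hF.image fun g => ‖(φ g).toAdd‖).bddAbove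
      refine ⟨⋂ f ∈ F, {m | ⟪m, (φ f).toAdd⟫ < -η}, ?_, η, hη, M, fun m hm => ⟨F, fun f hf =>
        ⟨(Set.mem_iInter₂.1 hm f hf).le, hM ⟨f, hf, rfl⟩⟩, hc⟩⟩
      refine mem_nhdsWithin_of_mem_nhds ((Filter.biInter_mem hF).2 fun f hf => ?_)
      exact (isOpen_lt (by fun_prop) continuous_const).mem_nhds (hηF f hf)
  obtain ⟨η, hη, M, hcode⟩ := hunif
  obtain ⟨n₀, hn₀⟩ := exists_norm_eq E zero_le_one
  obtain ⟨C₀, h₀⟩ := huni n₀ hn₀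
  -- Beyond radius `R`, coding in the direction of `v` replaces `‖v‖ ^ 2` by at most `‖v‖ ^ 2 - 2 *
  -- η * ‖v‖ + M ^ 2 < ‖v‖ ^ 2 - 1`, which drives the induction on `N`.
  set R : ℝ := max 1 ((M ^ 2 + 1) / (2 * η))
  refine ⟨ε, hε, R, fun p q hpq => h₀ p q ?_⟩
  have hall : ∀ N : ℕ, ∀ g : Γ, ‖(φ g).toAdd‖ ^ 2 ≤ N → dist (g • p) (g • q) ≤ ε := by
    intro N
    induction N with
    | zero =>
      intro g hg
      refine hpq g ?_
      have : ‖(φ g).toAdd‖ = 0 := by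
        rw [Nat.cast_zero] at hg
        exact pow_eq_zero_iff two_ne_zero |>.1 (le_antisymm hg (sq_nonneg _))
      rw [Set.mem_ofPred_eq, this]
      exact zero_le_one.trans (le_max_left _ _)
    | succ N ih =>
      intro g hg
      by_cases hgR : ‖(φ g).toAdd‖ ≤ R
      · exact hpq g hgR
      push Not at hgR
      set v := (φ g).toAdd
      have hv1 : 1 < ‖v‖ := (le_max_left _ _).trans_lt hgR
      have hv0 : 0 < ‖v‖ := one_pos.trans hv1
      have hvM : M ^ 2 + 1 < 2 * η * ‖v‖ := by
        have := (le_max_right _ _).trans_lt hgR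
        rw [div_lt_iff₀ (by positivity)] at this
        linarith
      obtain ⟨F, hF, hc⟩ := hcode (‖v‖⁻¹ • v) (by simp [norm_smul, hv0.ne'])
      refine hc _ _ fun f hf => ?_
      rw [← mul_smul, ← mul_smul]
      refine ih _ ?_
      obtain ⟨h1, h2⟩ := hF f hf
      rw [real_inner_smul_left, inv_mul_eq_div, div_le_iff₀ hv0] at h1
      rw [map_mul, toAdd_mul, add_comm, norm_add_sq_real]
      have h3 : ‖(φ f).toAdd‖ ^ 2 ≤ M ^ 2 := pow_le_pow_left₀ (norm_nonneg _) h2 2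
      push_cast at hg
      change ‖v‖ ^ 2 + 2 * ⟪v, (φ f).toAdd⟫ + _ ≤ _
      linarith
  intro g _
  obtain ⟨N, hN⟩ := exists_nat_ge (‖(φ g).toAdd‖ ^ 2)
  exact hall N g hN

end Coding

/-- Each of the `k * k` exchanges of an `a` with a `b` releases one central factor `z`. -/
theorem commutator_pow_of_central {Γ : Type*} [Group Γ] {a b z : Γ} (hz : ∀ g, Commute z g)
    (hab : a * b = z * (b * a)) (k : ℕ) :
    a ^ k * b ^ k * a⁻¹ ^ k * b⁻¹ ^ k = z ^ (k * k) := by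
  have h1 : ∀ m : ℕ, a * b ^ m = z ^ m * b ^ m * a := by
    intro m
    have : SemiconjBy a b (z * b) := by rw [SemiconjBy, hab, mul_assoc]
    rw [← (hz b).mul_pow]
    exact (this.pow_right m)
  have h2 : ∀ n m : ℕ, a ^ n * b ^ m = z ^ (n * m) * (b ^ m * a ^ n) := by
    intro n m
    induction n with
    | zero => simp
    | succ n ih =>
      calc a ^ (n + 1) * b ^ m = a ^ n * (a * b ^ m) := by rw [pow_succ, mul_assoc]
        _ = a ^ n * z ^ m * b ^ m * a := by rw [h1]; simp only [mul_assoc]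
        _ = z ^ m * (a ^ n * b ^ m) * a := by
          rw [← ((hz (a ^ n)).pow_left m).eq]; simp only [mul_assoc]
        _ = z ^ ((n + 1) * m) * (b ^ m * a ^ (n + 1)) := by
          rw [ih, pow_succ, add_mul, one_mul, add_comm, pow_add]; simp only [mul_assoc]
  rw [h2, inv_pow, inv_pow]
  group

/-! ### Quadratic distortion of a central commutator -/

section Central

variable {Γ X : Type*} [Group Γ] [MetricSpace X] [MulAction Γ X]

/-- The elements `t * z ^ m` with `t ∈ T` and `|m| ≤ L`. -/
def centralBlock (T : Set Γ) (z : Γ) (L : ℤ) : Set Γ :=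
  {g | ∃ t ∈ T, ∃ m : ℤ, |m| ≤ L ∧ g = t * z ^ m}

theorem finite_centralBlock {T : Set Γ} (hT : T.Finite) (z : Γ) (L : ℤ) :
    (centralBlock T z L).Finite := by
  refine ((hT.prod (Set.finite_Icc (-L) L)).image fun w => w.1 * z ^ w.2).subset ?_
  rintro _ ⟨t, ht, m, hm, rfl⟩
  exact ⟨(t, m), ⟨ht, abs_le.1 hm⟩, rfl⟩

theorem CloseOn.zpow_smul {ε : ℝ} {T : Set Γ} {z : Γ} {L L' m : ℤ} {p q : X}
    (h : CloseOn ε (centralBlock T z L') p q) (hL : L + |m| ≤ L') :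
    CloseOn ε (centralBlock T z L) (z ^ m • p) (z ^ m • q) := by
  rintro _ ⟨t, ht, i, hi, rfl⟩
  rw [← mul_smul, ← mul_smul]
  exact h _ ⟨t, ht, i + m, by linarith [abs_add_le i m], by rw [mul_assoc, ← zpow_add]⟩

variable [CompactSpace X] [ContinuousConstSMul Γ X]

/-- Applying one element of `S` shortens the controlled block by a fixed `r`: a finite code for `T *
S` fits in a block of length `r`, and its translates by powers of `z` work equally well because `z`
is central. -/
theorem exists_centralBlock_code {T : Set Γ} (hT : T.Finite) {z : Γ} (hz : ∀ g, Commute z g)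
    {ε : ℝ} (hε : 0 < ε)
    (hexp : ∀ p q : X, CloseOn ε {g : Γ | ∃ t ∈ T, ∃ m : ℤ, g = t * z ^ m} p q → p = q)
    {S : Set Γ} (hS : S.Finite) :
    ∃ r : ℕ, ∀ s ∈ S, ∀ (L : ℤ) (k : ℕ) (p q : X),
      CloseOn ε (centralBlock T z (L + k * r)) p q →
        CloseOn ε (centralBlock T z L) (s ^ k • p) (s ^ k • q) := by
  obtain ⟨F, hFS, hF, hcode⟩ := exists_finite_closeOn hexp hε (hT.image2 (· * ·) hS)
  obtain ⟨r, hr⟩ : ∃ r : ℕ, F ⊆ centralBlock T z r := by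
    have hFS' : ∀ f ∈ F, ∃ t ∈ T, ∃ m : ℤ, f = t * z ^ m := fun f hf => hFS hf
    choose! t ht m hm using hFS'
    obtain ⟨r, hr⟩ := (hF.image fun f => (m f).natAbs).bddAbove
    refine ⟨r, fun f hf => ⟨t f, ht f hf, m f, ?_, hm f hf⟩⟩
    have : (m f).natAbs ≤ r := hr ⟨f, hf, rfl⟩
    rw [Int.abs_eq_natAbs]
    exact_mod_cast this
  have hstep : ∀ s ∈ S, ∀ (L : ℤ) (p q : X), CloseOn ε (centralBlock T z (L + r)) p q →
      CloseOn ε (centralBlock T z L) (s • p) (s • q) := by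
    rintro s hs L p q h _ ⟨t, ht, m, hm, rfl⟩
    have h1 : CloseOn ε F (z ^ m • p) (z ^ m • q) :=
      (h.zpow_smul (L := r) (by linarith)).mono hr le_rfl
    have h2 := (hcode _ _ h1 (t * s) (Set.mem_image2_of_mem ht hs)).le
    rwa [← mul_smul, ← mul_smul, mul_assoc, ← ((hz s).zpow_left m).eq, ← mul_assoc, mul_smul,
      mul_smul (t * z ^ m)] at h2
  refine ⟨r, fun s hs L k => ?_⟩
  induction k with
  | zero =>
    intro p q h
    simpa using h
  | succ k ih =>
    intro p q h
    rw [pow_succ, mul_smul, mul_smul]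
    refine ih _ _ (hstep s hs _ _ _ (h.mono (subset_of_eq ?_) le_rfl))
    congr 1
    push_cast
    ring

/-- A group acting on an infinite compact metric space does not contain a central element which is
a commutator and which generates an expansive subgroup (up to finitely many cosets). -/
theorem finite_of_expansive_central_commutator {a b z : Γ} (hz : ∀ g, Commute z g)
    (hab : a * b = z * (b * a)) {T : Set Γ} (hT : T.Finite) {ε : ℝ} (hε : 0 < ε)
    (hexp : ∀ p q : X, CloseOn ε {g : Γ | ∃ t ∈ T, ∃ m : ℤ, g = t * z ^ m} p q → p = q) :
    Finite X := by
  obtain ⟨r, hr⟩ := exists_centralBlock_code (X := X) hT hz hε hexp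
    (Set.toFinite {a, b, a⁻¹, b⁻¹})
  -- The commutator word costs `4 * k * r`, and this `k` makes the cost at most `k * k - 1`, so a
  -- block of length `N` reaches the first uncontrolled exponents `±(N + 1)`.
  let k : ℕ := 4 * r + 1
  let N : ℤ := k * k - 1
  have hN : (0 : ℤ) + k * r + k * r + k * r + k * r ≤ N := by
    simp only [N, k]
    push_cast
    nlinarith [Int.natCast_nonneg r]
  have hpow : ∀ p q : X, CloseOn ε (centralBlock T z N) p q →
      CloseOn ε (centralBlock T z 0) (z ^ (k * k) • p) (z ^ (k * k) • q) ∧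
      CloseOn ε (centralBlock T z 0) ((z ^ (k * k))⁻¹ • p) ((z ^ (k * k))⁻¹ • q) := by
    intro p q h
    have h' : CloseOn ε (centralBlock T z (0 + k * r + k * r + k * r + k * r)) p q :=
      h.mono (by rintro _ ⟨t, ht, m, hm, rfl⟩; exact ⟨t, ht, m, hm.trans hN, rfl⟩) le_rfl
    rw [← commutator_pow_of_central hz hab k]
    constructor
    · simp only [mul_smul]
      exact hr _ (by simp) _ _ _ _ <| hr _ (by simp) _ _ _ _ <| hr _ (by simp) _ _ _ _ <|
        hr _ (by simp) _ _ _ _ h'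
    · simp only [mul_inv_rev, ← inv_pow, inv_inv, mul_smul]
      exact hr _ (by simp) _ _ _ _ <| hr _ (by simp) _ _ _ _ <| hr _ (by simp) _ _ _ _ <|
        hr _ (by simp) _ _ _ _ h'
  have hshift : ∀ p q : X, CloseOn ε (centralBlock T z N) p q →
      CloseOn ε (centralBlock T z (k * k)) p q := by
    rintro p q h _ ⟨t, ht, m, hm, rfl⟩
    obtain ⟨h1, h2⟩ := hpow p q h
    have hN' : N + 1 = k * k := by simp [N]
    rcases lt_or_eq_of_le hm with hlt | heq
    · exact h _ ⟨t, ht, m, by omega, rfl⟩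
    · rcases abs_choice m with hm' | hm'
      · have e : m = ((k * k : ℕ) : ℤ) := by rw [← hm', heq]; push_cast; rfl
        have := h1 _ ⟨t, ht, 0, by simp, rfl⟩
        rwa [zpow_zero, mul_one, ← zpow_natCast, ← e, ← mul_smul, ← mul_smul] at this
      · have e : m = -((k * k : ℕ) : ℤ) := by
          push_cast
          omega
        have := h2 _ ⟨t, ht, 0, by simp, rfl⟩
        rwa [zpow_zero, mul_one, ← zpow_natCast, ← zpow_neg, ← e, ← mul_smul, ← mul_smul] at this
  have hN' : N + 1 = k * k := by simp [N]
  have hN0 : 0 ≤ N := by nlinarith [Int.natCast_nonneg r, Int.natCast_nonneg k]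
  -- The gain of one exponent at each end lets the hypothesis be shifted by `z` or `z⁻¹` and
  -- iterated along all of `⟨z⟩`.
  have hfix : ∀ p q : X, CloseOn ε (centralBlock T z N) p q → p = q := by
    intro p q h
    have hall : ∀ m : ℤ, CloseOn ε (centralBlock T z N) (z ^ m • p) (z ^ m • q) := by
      intro m
      induction m using Int.induction_on with
      | zero => simpa using h
      | succ i ih =>
        rw [add_comm, zpow_add, mul_smul, mul_smul]
        exact (hshift _ _ ih).zpow_smul (by simp [← hN'])
      | pred i ih =>
        rw [sub_eq_add_neg, add_comm, zpow_add, mul_smul, mul_smul]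
        exact (hshift _ _ ih).zpow_smul (by simp [← hN'])
    refine hexp p q ?_
    rintro _ ⟨t, ht, m, rfl⟩
    have := hall m _ ⟨t, ht, 0, by simpa using hN0, rfl⟩
    rwa [zpow_zero, mul_one, ← mul_smul, ← mul_smul] at this
  have : DiscreteTopology X := by
    rw [discreteTopology_iff_isOpen_singleton]
    intro p
    have hopen : IsOpen (⋂ g ∈ centralBlock T z N, {q : X | dist (g • p) (g • q) < ε}) :=
      (finite_centralBlock hT z N).isOpen_biInter fun g _ =>
        isOpen_lt (by fun_prop) continuous_const
    convert hopen
    refine Set.Subset.antisymm ?_ fun q hq => ?_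
    · rintro _ rfl
      simpa using fun _ _ => hε
    · exact (hfix p q fun g hg => (Set.mem_iInter₂.1 hq g hg).le).symm
  exact finite_of_compact_of_discrete

end Central

/-! ### The discrete Heisenberg group and its vertical slabs -/

namespace Heisenberg

variable {D : ℕ}

open scoped RealInnerProductSpace

/-- The projection of the discrete Heisenberg group to the horizontal layer. -/
noncomputable def horizontal (D : ℕ) :
    discrete D →* Multiplicative (EuclideanSpace ℝ (Fin D ⊕ Fin D)) where
  toFun g := Multiplicative.ofAdd (g : Heisenberg D).v
  map_one' := rfl
  map_mul' _ _ := rfl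

@[simp] theorem toAdd_horizontal (g : discrete D) :
    (horizontal D g).toAdd = (g : Heisenberg D).v := rfl

theorem x_mem_discrete (i : Fin D) : x i ∈ discrete D :=
  Subgroup.subset_closure (Or.inl ⟨i, rfl⟩)

theorem y_mem_discrete (i : Fin D) : y i ∈ discrete D :=
  Subgroup.subset_closure (Or.inr ⟨i, rfl⟩)

theorem exists_inner_horizontal_ne_zero {n : EuclideanSpace ℝ (Fin D ⊕ Fin D)} (hn : n ≠ 0) :
    ∃ g, ⟪n, (horizontal D g).toAdd⟫ ≠ 0 := by
  by_contra! h
  refine hn ?_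
  ext j
  rcases j with i | i
  · simpa [x, EuclideanSpace.inner_single_right] using h ⟨x i, x_mem_discrete i⟩
  · simpa [y, EuclideanSpace.inner_single_right] using h ⟨y i, y_mem_discrete i⟩

/-- Elements of the discrete Heisenberg group have integral horizontal coordinates, and their
central coordinate is integral up to a shift determined by the horizontal ones. -/
theorem exists_int_of_mem_discrete {g : Heisenberg D} (hg : g ∈ discrete D) :
    ∃ (a : Fin D ⊕ Fin D → ℤ) (c : ℤ), (∀ j, g.v j = a j) ∧
      g.u = (1 / 2 : ℝ) * ∑ i, (a (Sum.inl i) : ℝ) * a (Sum.inr i) + c := by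
  classical
  induction hg using Subgroup.closure_induction with
  | mem g hg =>
    rcases hg with ⟨i, rfl⟩ | ⟨i, rfl⟩
    · refine ⟨Pi.single (Sum.inl i) 1, 0, fun j => ?_, ?_⟩
      · by_cases hj : j = Sum.inl i <;> simp [x, hj]
      · simp [x]
    · refine ⟨Pi.single (Sum.inr i) 1, 0, fun j => ?_, ?_⟩
      · by_cases hj : j = Sum.inr i <;> simp [y, hj]
      · simp [y]
  | one => exact ⟨0, 0, by simp, by simp⟩
  | mul g h _ _ ihg ihh =>
    obtain ⟨a, c, ha, hc⟩ := ihg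
    obtain ⟨a', c', ha', hc'⟩ := ihh
    refine ⟨a + a', c + c' - ∑ i, a (Sum.inr i) * a' (Sum.inl i), fun j => ?_, ?_⟩
    · simp [ha, ha']
    · simp only [mul_u, hc, hc', symplecticForm, ha, ha', Pi.add_apply]
      push_cast
      simp only [add_mul, mul_add, Finset.sum_add_distrib, Finset.sum_sub_distrib,
        mul_comm (a' (Sum.inl _) : ℝ) (a (Sum.inr _) : ℝ)]
      ring
  | inv g _ ih =>
    obtain ⟨a, c, ha, hc⟩ := ih
    refine ⟨-a, -c - ∑ i, a (Sum.inl i) * a (Sum.inr i), fun j => by simp [ha], ?_⟩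
    simp only [inv_u, hc, Pi.neg_apply]
    push_cast
    simp only [neg_mul_neg]
    ring

theorem finite_horizontal_image (R : ℝ) :
    ((fun g : discrete D => (g : Heisenberg D).v) ''
      {g | ‖(horizontal D g).toAdd‖ ≤ R}).Finite := by
  obtain ⟨N, hN⟩ := exists_nat_ge R
  refine ((Set.finite_Icc (fun _ => -(N : ℤ)) (fun _ : Fin D ⊕ Fin D => (N : ℤ))).image
    fun a => WithLp.toLp 2 fun j => (a j : ℝ)).subset ?_
  rintro _ ⟨g, hg, rfl⟩
  obtain ⟨a, -, ha, -⟩ := exists_int_of_mem_discrete g.2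
  have hb : ∀ j, |a j| ≤ N := by
    intro j
    have h1 : ‖(g : Heisenberg D).v j‖ ≤ N := (PiLp.norm_apply_le _ j).trans (hg.trans hN)
    rw [ha, Real.norm_eq_abs] at h1
    exact_mod_cast h1
  refine ⟨a, ⟨fun j => (abs_le.1 (hb j)).1, fun j => (abs_le.1 (hb j)).2⟩, ?_⟩
  ext j
  simp [ha]

/-- Equal horizontal parts give equal half-integral shifts, so the central coordinates differ by an
integer. -/
theorem exists_eq_mul_zpow {z : discrete D} (hzv : (z : Heisenberg D).v = 0)
    (hzu : (z : Heisenberg D).u = 1) {g h : discrete D}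
    (hgh : (g : Heisenberg D).v = (h : Heisenberg D).v) : ∃ m : ℤ, g = h * z ^ m := by
  obtain ⟨a, c, ha, hc⟩ := exists_int_of_mem_discrete g.2
  obtain ⟨a', c', ha', hc'⟩ := exists_int_of_mem_discrete h.2
  have haa : a = a' := by
    ext j
    have := ha j
    rw [hgh, ha'] at this
    exact Int.cast_injective (α := ℝ) this.symm
  subst haa
  have hz : (z : Heisenberg D) = ⟨0, 1⟩ := Heisenberg.ext hzv hzu
  have hpow : ∀ m : ℤ, ((⟨0, 1⟩ : Heisenberg D)) ^ m = ⟨0, m⟩ := by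
    intro m
    induction m using Int.induction_on with
    | zero => ext1 <;> simp
    | succ i ih =>
      rw [zpow_add_one, ih]
      ext1 <;> simp [symplecticForm]
    | pred i ih =>
      rw [zpow_sub_one, ih]
      ext1 <;> simp [symplecticForm, sub_eq_add_neg]
  refine ⟨c - c', Subtype.ext ?_⟩
  rw [Subgroup.coe_mul, Subgroup.coe_zpow, hz, hpow]
  ext1
  · simp [hgh]
  · simp [hc, hc', symplecticForm]

/-- The vertical group over a linear subspace. -/
def verticalSubgroup (V : Submodule ℝ (EuclideanSpace ℝ (Fin D ⊕ Fin D))) :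
    Subgroup (Heisenberg D) where
  carrier := {g | g.v ∈ V}
  mul_mem' hg hh := V.add_mem hg hh
  one_mem' := V.zero_mem
  inv_mem' hg := V.neg_mem hg

theorem isVerticalGroup_verticalSubgroup (V : Submodule ℝ (EuclideanSpace ℝ (Fin D ⊕ Fin D))) :
    IsVerticalGroup (verticalSubgroup V) (Module.finrank ℝ V + 1) := by
  refine ⟨⟨fun n hn g => ?_⟩, V, rfl, rfl⟩
  change g.v + n.v + -g.v ∈ V
  rwa [add_neg_cancel_comm]

/-- An expansive vertical hyperplane group gives an expansive slab. -/
theorem IsExpansive.exists_slab {d : Heisenberg D → Heisenberg D → ℝ}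
    (hd : IsHomogeneousMetric d) {X : Type*} [MetricSpace X] [MulAction (discrete D) X]
    {n : EuclideanSpace ℝ (Fin D ⊕ Fin D)} (hn : ‖n‖ = 1)
    (hexp : IsExpansive d X (verticalSubgroup (ℝ ∙ n)ᗮ : Set (Heisenberg D))) :
    ∃ ε > 0, ∃ C : ℝ, ∀ p q : X,
      CloseOn ε {g : discrete D | |⟪n, (horizontal D g).toAdd⟫| ≤ C} p q → p = q := by
  obtain ⟨K, hK, hbound⟩ := hd.exists_norm_v_le
  obtain ⟨ε, hε, t, ht, h⟩ := hexp
  refine ⟨ε, hε, K * (t + 1), fun p q hpq => h p q ?_⟩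
  refine iSup₂_le fun g hg => ?_
  rw [edist_dist]
  refine ENNReal.ofReal_le_ofReal (hpq g ?_)
  -- The infimum is not known to be attained; the slack `t + 1` provides an actual nearby `w`.
  have hlt : (⨅ h ∈ (verticalSubgroup (ℝ ∙ n)ᗮ : Set (Heisenberg D)),
      ENNReal.ofReal (d g h)) < ENNReal.ofReal (t + 1) :=
    lt_of_le_of_lt hg ((ENNReal.ofReal_lt_ofReal_iff (by linarith)).2 (by linarith))
  obtain ⟨w, hw⟩ := iInf_lt_iff.1 hlt
  obtain ⟨hwV, hw⟩ := iInf_lt_iff.1 hw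
  have hdw : d g w < t + 1 := (ENNReal.ofReal_lt_ofReal_iff (by linarith)).1 hw
  have hnw : ⟪n, w.v⟫ = 0 := Submodule.mem_orthogonal_singleton_iff_inner_right.1 hwV
  have hnorm := hbound (g * w⁻¹)
  rw [← hd.eq_mul_inv_one, mul_v, inv_v, ← sub_eq_add_neg] at hnorm
  rw [Set.mem_ofPred_eq, toAdd_horizontal]
  calc |⟪n, (g : Heisenberg D).v⟫| = |⟪n, (g : Heisenberg D).v - w.v⟫| := by
        rw [inner_sub_right, hnw, sub_zero]
    _ ≤ ‖n‖ * ‖(g : Heisenberg D).v - w.v‖ := abs_real_inner_le_norm _ _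
    _ ≤ K * (t + 1) := by
        rw [hn, one_mul]
        exact hnorm.trans (mul_le_mul_of_nonneg_left hdw.le hK.le)

end Heisenberg

/-! ### The main theorem -/

theorem theorem5p13 (D : ℕ) (hD : 1 ≤ D)
    (d : Heisenberg D → Heisenberg D → ℝ) (hd : Heisenberg.IsHomogeneousMetric d)
    (X : Type*) [MetricSpace X] [CompactSpace X]
    [MulAction (Heisenberg.discrete D) X] [ContinuousConstSMul (Heisenberg.discrete D) X]
    (hX : Infinite X) :
    ∃ G : Subgroup (Heisenberg D), Heisenberg.IsVerticalGroup G (2 * D) ∧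
      ¬ Heisenberg.IsExpansive d X (G : Set (Heisenberg D)) := by
  by_contra! hall
  refine hX.not_finite ?_
  let i₀ : Fin D := ⟨0, hD⟩
  have : Nonempty (Fin D ⊕ Fin D) := ⟨Sum.inl i₀⟩
  obtain ⟨ε, hε, R, hR⟩ := exists_closeOn_cylinder (X := X) (Heisenberg.horizontal D)
    (fun n hn => Heisenberg.exists_inner_horizontal_ne_zero hn) fun n hn => by
      refine Heisenberg.IsExpansive.exists_slab hd hn (hall _ ?_)
      have hdim : 2 * D = Module.finrank ℝ ((ℝ ∙ n)ᗮ : Submodule ℝ _) + 1 := by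
        have h1 := (ℝ ∙ n).finrank_add_finrank_orthogonal
        rw [finrank_span_singleton (norm_ne_zero_iff.1 (by simp [hn])), finrank_euclideanSpace,
          Fintype.card_sum, Fintype.card_fin] at h1
        omega
      rw [hdim]
      exact Heisenberg.isVerticalGroup_verticalSubgroup _
  let a : Heisenberg.discrete D := ⟨Heisenberg.x i₀, Heisenberg.x_mem_discrete i₀⟩
  let b : Heisenberg.discrete D := ⟨Heisenberg.y i₀, Heisenberg.y_mem_discrete i₀⟩
  let z : Heisenberg.discrete D := a * b * (b * a)⁻¹
  have hab : a * b = z * (b * a) := (inv_mul_cancel_right _ _).symm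
  have hzv : (z : Heisenberg D).v = 0 := by
    simp only [z, Subgroup.coe_mul, Subgroup.coe_inv, Heisenberg.mul_v, Heisenberg.inv_v]
    abel
  have hzu : (z : Heisenberg D).u = 1 := by
    simp [z, a, b, Heisenberg.x, Heisenberg.y, symplecticForm, PiLp.single_apply]
    norm_num
  have hz : ∀ g, Commute z g := fun g => Subtype.ext <| by
    ext1
    · simp [hzv]
    · simp [hzv, hzu, symplecticForm, add_comm]
  -- `T` picks one element over each of the finitely many lattice vectors of norm at most `R`, so
  -- the cylinder lies in `T * ⟨z⟩`.
  obtain ⟨T, -, hT⟩ := Set.exists_subset_bijOn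
    {g : Heisenberg.discrete D | ‖(Heisenberg.horizontal D g).toAdd‖ ≤ R}
    (fun g => (g : Heisenberg D).v)
  have hTfin : T.Finite := hT.finite_iff_finite.2 (Heisenberg.finite_horizontal_image R)
  refine finite_of_expansive_central_commutator hz hab hTfin hε fun p q hpq =>
    hR p q (hpq.mono (fun g hg => ?_) le_rfl)
  obtain ⟨t, ht, htg⟩ := hT.surjOn ⟨g, hg, rfl⟩
  exact ⟨t, ht, Heisenberg.exists_eq_mul_zpow hzv hzu htg.symm⟩
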